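/- Let $n\ge 1$ and $p\ge 1$. For $\mathcal A\in\mathbb C^{m\times n\times p}$ with frontal slices $A^{(1)},\dots,A^{(p)}\in\mathbb C^{m\times n}$, let $\operatorname{bcirc}(\mathcal A)\in\mathbb C^{mp\times np}$ be the block circulant matrix whose $(k,l)$ block is $A^{(1+((k-l)\bmod p))}$, and let $\operatorname{unfold}(\mathcal A)\in\mathbb C^{mp\times n}$ be the matrix of the slices stacked on top of each other, with inverse operation $\operatorname{fold}$. The T-product is $\mathcal A*\mathcal B=\operatorname{fold}(\operatorname{bcirc}(\mathcal A)\operatorname{unfold}(\mathcal B))$; the identity tensor $\mathcal I_{n,p}$ has first slice $I_n$ and all other slices $0$; inverses are taken with respect to $*$ and $\mathcal I_{n,p}$; $\mathcal A^H$ has the slices $(A^{(1)})^H,(A^{(p)})^H,\dots,(A^{(2)})^H$; and $\operatorname{tr}(\mathcal A)=\operatorname{tr}(\operatorname{bcirc}(\mathcal A))$ for $\mathcal A\in\mathbb C^{n\times n\times p}$. Let $\mathbb H^{n\times n\times p}=\{\mathcal A\in\mathbb C^{n\times n\times p}:\mathcal A^H=\mathcal A\}$, and let $\mathbb H_{++}^{n\times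 n\times p}$ be the set of T-positive definite tensors, i.e. of all $\mathcal A\in\mathbb H^{n\times n\times p}$ with $\langle\mathcal X,\mathcal A*\mathcal X\rangle>0$ for every nonzero $\mathcal X\in\mathbb C^{n\times1\times p}$, where $\langle\mathcal X,\mathcal Y\rangle=\sum_{i,j,k}\overline{x_{ijk}}\,y_{ijk}$. Equip $\mathbb H_{++}^{n\times n\times p}$, an open subset of the real vector space $\mathbb H^{n\times n\times p}$, with the Riemannian metric $$g_{\mathcal P}(\mathcal X,\mathcal Y)=\operatorname{tr}(\mathcal P^{-1}*\mathcal X*\mathcal P^{-1}*\mathcal Y),\qquad \mathcal X,\mathcal Y\in\mathbb H^{n\times n\times p},$$ and let $$\delta(\mathcal A,\mathcal B)=\inf_\gamma\int_a^b\sqrt{g_{\gamma(t)}(\gamma'(t),\gamma'(t))}\,dt$$ be the associated Riemannian distance, the infimum being taken over all piecewise smooth paths $\gamma:[a,b]\to\mathbb H_{++}^{n\times n\times p}$ from $\mathcal A$ to $\mathcal B$. **Theorem.** $\delta$ is a (finite) metric on $\mathbb H_{++}^{n\times n\times p}$, and the metric space $(\mathbb H_{++}^{n\times n\times p},\delta)$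 is complete. -/

import Mathlib

open MeasureTheory Set
open scoped ENNReal ContDiff

noncomputable section

namespace TProduct

/-- Third-order complex tensors `ℂ^{m × n × p}`. The entry `a_{ijk}` is `A (i, j, k)` with indices
starting from `0`, so that the frontal slice `A^{(k+1)}` is `fun i j => A (i, j, k)`. The inner
product and the norm of `EuclideanSpace` are the Frobenius inner product
`∑ conj a_{ijk} * b_{ijk}` and the Frobenius norm. -/
abbrev Tensor (m n p : ℕ) : Type := EuclideanSpace ℂ (Fin m × Fin n × Fin p)

/-- The block circulant matrix of a tensor: its block in block row `k` and block column `l` is the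
frontal slice of index `k - l`, the subtraction in `Fin p` being modulo `p`. -/
def bcirc {m n p : ℕ} (A : Tensor m n p) : Matrix (Fin p × Fin m) (Fin p × Fin n) ℂ :=
  Matrix.of fun r c => A (r.2, c.2, r.1 - c.1)

/-- The frontal slices stacked on top of each other. -/
def unfold {m n p : ℕ} (A : Tensor m n p) : Matrix (Fin p × Fin m) (Fin n) ℂ :=
  Matrix.of fun r j => A (r.2, j, r.1)

/-- The inverse of `unfold`. -/
def fold {m n p : ℕ} (M : Matrix (Fin p × Fin m) (Fin n) ℂ) : Tensor m n p :=
  WithLp.toLp 2 fun x => M (x.2.2, x.1) x.2.1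

/-- The T-product `A * B = fold (bcirc A ⬝ unfold B)`. -/
def tmul {m n s p : ℕ} (A : Tensor m n p) (B : Tensor n s p) : Tensor m s p :=
  fold (bcirc A * unfold B)

/-- The identity tensor: the first frontal slice is the identity matrix, the others vanish. -/
def tone (n p : ℕ) [NeZero p] : Tensor n n p :=
  WithLp.toLp 2 fun x => if x.2.2 = 0 ∧ x.1 = x.2.1 then 1 else 0

open Classical in
/-- The inverse of a frontal square tensor with respect to the T-product
(and `0` for a singular tensor). -/
def tinv {n p : ℕ} [NeZero p] (A : Tensor n n p) : Tensor n n p :=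
  if h : ∃ X : Tensor n n p, tmul A X = tone n p ∧ tmul X A = tone n p then h.choose else 0

/-- The T-conjugate transpose: conjugate transpose every frontal slice and reverse the order of
the slices `2, …, p`, i.e. replace the slice index `k` (counted from `0`) by `-k` modulo `p`. -/
def tconj {m n p : ℕ} [NeZero p] (A : Tensor m n p) : Tensor n m p :=
  WithLp.toLp 2 fun x => star (A (x.2.1, x.1, -x.2.2))

/-- T-Hermitian tensors. -/
def IsTHermitian {n p : ℕ} [NeZero p] (A : Tensor n n p) : Prop := tconj A = A

/-- T-positive definite tensors. For a T-Hermitian `A` the number `⟨X, A * X⟩` is real. -/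
def IsTPosDef {n p : ℕ} [NeZero p] (A : Tensor n n p) : Prop :=
  IsTHermitian A ∧ ∀ X : Tensor n 1 p, X ≠ 0 → 0 < (inner ℂ X (tmul A X)).re

/-- The space `ℍ₊₊^{n × n × p}` of T-positive definite tensors, without any preassigned distance. -/
def TPosDef (n p : ℕ) [NeZero p] : Type := {A : Tensor n n p // IsTPosDef A}

/-- The trace of a frontal square tensor. -/
def ttrace {n p : ℕ} (A : Tensor n n p) : ℂ := (bcirc A).trace

/-- The Riemannian metric `g_P(X, Y) = tr (P⁻¹ * X * P⁻¹ * Y)` at a T-positive definite `P`, for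
T-Hermitian `X`, `Y`; the trace is then real. -/
def riemMetric {n p : ℕ} [NeZero p] (P X Y : Tensor n n p) : ℝ :=
  (ttrace (tmul (tmul (tmul (tinv P) X) (tinv P)) Y)).re

/-- `γ` is piecewise smooth on `[a, b]`: it is continuous, and for some finite set `s` of break
points it is smooth (up to the end points) on each subinterval whose interior avoids `s`. -/
def IsPiecewiseSmooth {E : Type*} [NormedAddCommGroup E] [NormedSpace ℝ E]
    (γ : ℝ → E) (a b : ℝ) : Prop :=
  ContinuousOn γ (Icc a b) ∧
    ∃ s : Finset ℝ, ∀ c d : ℝ, a ≤ c → c < d → d ≤ b → (∀ t ∈ Ioo c d, t ∉ s) →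
      ContDiffOn ℝ ∞ γ (Icc c d)

/-- `γ`, restricted to `[a, b]`, is a piecewise smooth path from `A` to `B` in the space of
T-positive definite tensors. (This space is open in the real vector subspace of T-Hermitian
tensors, so smoothness may be tested in the space of all tensors.) -/
structure IsPath {n p : ℕ} [NeZero p] (A B : TPosDef n p) (a b : ℝ) (γ : ℝ → Tensor n n p) :
    Prop where
  lt : a < b
  mem : ∀ t ∈ Icc a b, IsTPosDef (γ t)
  smooth : IsPiecewiseSmooth γ a b
  source : γ a = A.1
  target : γ b = B.1

/-- The Riemannian length `∫_a^b √(g_{γ(t)}(γ'(t), γ'(t))) dt`; the finitely many points at which a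
piecewise smooth path is not differentiable do not matter. -/
def length {n p : ℕ} [NeZero p] (a b : ℝ) (γ : ℝ → Tensor n n p) : ℝ≥0∞ :=
  ∫⁻ t in Icc a b, ENNReal.ofReal √(riemMetric (γ t) (deriv γ t) (deriv γ t))

/-- The Riemannian distance: the infimum of the lengths of the piecewise smooth paths from `A` to
`B` (it would be `∞` if there were no such path). -/
def riemDist {n p : ℕ} [NeZero p] (A B : TPosDef n p) : ℝ≥0∞ :=
  ⨅ (a : ℝ) (b : ℝ) (γ : ℝ → Tensor n n p) (_ : IsPath A B a b γ), length a b γ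

end TProduct

end

/-!
The map `bcirc` is an injective homomorphism for product, identity and conjugate transpose
(`bcirc_tmul`, `bcirc_tone`, `bcirc_tconj`), and a tensor is T-positive definite exactly if its
block circulant matrix is positive definite (`isTPosDef_iff_posDef`). All estimates are made with
the quadratic forms `q_x(A) = Re (xᴴ (bcirc A) x)`.

*Lower bound.* Cauchy–Schwarz for the form `tr (P⁻¹ X P⁻¹ Y)`, applied to `X` and the rank one
matrix `P x xᴴ P`, gives `|q_x(X)| ≤ √(g_P(X, X)) * q_x(P)` (`abs_quadForm_le`). Hence along a path
the derivative of `log q_x` is bounded by the speed, and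
`|log q_x(B) - log q_x(A)| ≤ δ(A, B)` for all `x ≠ 0` (`abs_log_quadForm_sub_le_riemDist`).
As the quadratic forms determine a T-Hermitian tensor by polarization, `δ` separates points.

*Upper bound.* The T-positive definite tensors form a convex set, so line segments are paths. Since
the metric is continuous on compact segments, `δ` is finite (`riemDist_lt_top`); since it is
continuous jointly in the base point and the tangent vector, `δ(A, B)` is small when `B` is close
to `A` in the Frobenius norm (`exists_riemDist_le`).

*Completeness.* Along a `δ`-Cauchy sequence every `log q_x` is Cauchy by the lower bound. Therefore
every `q_x` converges to a positive limit and, by polarization, the tensors converge entrywise to a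
tensor which is again T-positive definite (`exists_tendsto_of_cauchySeq_log`). By the upper bound
the convergence also holds for `δ`.

Symmetry and the triangle inequality come from reversing and concatenating paths.
-/

noncomputable section

namespace TProduct

open Filter Topology Matrix
open scoped ComplexOrder MatrixOrder

variable {m n s p : ℕ}

/-! ### The block circulant representation -/

lemma bcirc_injective [NeZero p] :
    Function.Injective (bcirc : Tensor m n p → Matrix (Fin p × Fin m) (Fin p × Fin n) ℂ) := by
  intro A B h
  ext ⟨i, j, k⟩
  simpa [bcirc] using congrFun (congrFun h (k, i)) (0, j)

lemma bcirc_tmul [NeZero p] (A : Tensor m n p) (B : Tensor n s p) :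
    bcirc (tmul A B) = bcirc A * bcirc B := by
  ext ⟨k, i⟩ ⟨l, j⟩
  simp only [bcirc, tmul, fold, unfold, Matrix.mul_apply, Matrix.of_apply, Fintype.sum_prod_type]
  -- reindex the sum over slices by the shift `t ↦ t + l`
  refine Fintype.sum_equiv (Equiv.addRight l) _ _ fun t => ?_
  simp [sub_sub, add_comm]

lemma bcirc_tone [NeZero p] : bcirc (tone n p) = 1 := by
  ext ⟨k, i⟩ ⟨l, j⟩
  simp [bcirc, tone, Matrix.one_apply, sub_eq_zero]

lemma bcirc_tconj [NeZero p] (A : Tensor m n p) : bcirc (tconj A) = (bcirc A)ᴴ := by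
  ext ⟨k, i⟩ ⟨l, j⟩
  simp [bcirc, tconj]

lemma isTHermitian_iff [NeZero p] {A : Tensor n n p} :
    IsTHermitian A ↔ (bcirc A).IsHermitian := by
  rw [IsTHermitian, Matrix.IsHermitian, ← bcirc_tconj, bcirc_injective.eq_iff]

lemma bcirc_add (A B : Tensor m n p) : bcirc (A + B) = bcirc A + bcirc B := rfl

lemma bcirc_neg (A : Tensor m n p) : bcirc (-A) = -bcirc A := rfl

lemma bcirc_smul (r : ℝ) (A : Tensor m n p) : bcirc (r • A) = r • bcirc A := rfl

lemma continuous_bcirc :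
    Continuous (bcirc : Tensor m n p → Matrix (Fin p × Fin m) (Fin p × Fin n) ℂ) :=
  continuous_matrix fun r c => by
    simp only [bcirc, Matrix.of_apply]
    fun_prop

/-- The real quadratic form `A ↦ Re (xᴴ (bcirc A) x)`, as a continuous real-linear functional of
the tensor `A`. -/
def quadForm (x : Fin p × Fin n → ℂ) : Tensor n n p →L[ℝ] ℝ :=
  LinearMap.toContinuousLinearMap
    { toFun := fun A => (star x ⬝ᵥ bcirc A *ᵥ x).re
      map_add' := fun A B => by simp [bcirc_add, Matrix.add_mulVec]
      map_smul' := fun r A => by simp [bcirc_smul, Matrix.smul_mulVec] }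

lemma quadForm_apply (x : Fin p × Fin n → ℂ) (A : Tensor n n p) :
    quadForm x A = (star x ⬝ᵥ bcirc A *ᵥ x).re := rfl

/-- For a single lateral slice `X`, the inner product `⟨X, A * X⟩` is the quadratic form of
`bcirc A` at the column vector `unfold X`. -/
lemma re_inner_tmul (A : Tensor n n p) (X : Tensor n 1 p) :
    (inner ℂ X (tmul A X)).re = quadForm (fun r => X (r.2, 0, r.1)) A := by
  rw [quadForm_apply]
  congr 1
  simp only [PiLp.inner_apply, RCLike.inner_apply, dotProduct, Fintype.sum_prod_type, tmul, fold,
    unfold, Matrix.mul_apply, mulVec, Matrix.of_apply, Finset.univ_unique, Finset.sum_singleton,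
    Fin.default_eq_zero]
  rw [Finset.sum_comm]
  simp [mul_comm]

lemma isTPosDef_iff_quadForm [NeZero p] {A : Tensor n n p} :
    IsTPosDef A ↔ IsTHermitian A ∧ ∀ x : Fin p × Fin n → ℂ, x ≠ 0 → 0 < quadForm x A := by
  refine and_congr_right fun _ => ⟨fun h x hx => ?_, fun h X hX => ?_⟩
  · have := h (WithLp.toLp 2 fun a => x (a.2.2, a.1)) fun h0 => hx <| by
      ext ⟨k, i⟩
      simpa using congrArg (fun Y : Tensor n 1 p => Y (i, 0, k)) h0
    rwa [re_inner_tmul] at this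
  · rw [re_inner_tmul]
    refine h _ fun h0 => hX ?_
    ext ⟨i, j, k⟩
    obtain rfl := Subsingleton.elim j 0
    exact congrFun h0 (k, i)

lemma isTPosDef_iff_posDef [NeZero p] {A : Tensor n n p} :
    IsTPosDef A ↔ (bcirc A).PosDef := by
  rw [isTPosDef_iff_quadForm, posDef_iff_dotProduct_mulVec, isTHermitian_iff]
  refine and_congr_right fun hA => forall₂_congr fun x _ => ?_
  rw [quadForm_apply, Complex.pos_iff]
  have him : (star x ⬝ᵥ bcirc A *ᵥ x).im = 0 := hA.im_star_dotProduct_mulVec_self x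
  simp [him]

lemma bcirc_tinv [NeZero p] {A : Tensor n n p} (hA : IsUnit (bcirc A)) :
    bcirc (tinv A) = (bcirc A)⁻¹ := by
  have hdet := (Matrix.isUnit_iff_isUnit_det _).1 hA
  have hex : ∃ X : Tensor n n p, tmul A X = tone n p ∧ tmul X A = tone n p := by
    -- solving `bcirc A * unfold X = unfold I` gives a right inverse, hence an inverse
    have hX : tmul A (fold ((bcirc A)⁻¹ * unfold (tone n p))) = tone n p := by
      change fold (bcirc A * ((bcirc A)⁻¹ * unfold (tone n p))) = _
      rw [Matrix.mul_nonsing_inv_cancel_left _ _ hdet]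
      rfl
    refine ⟨_, hX, bcirc_injective ?_⟩
    have h1 := congrArg bcirc hX
    rw [bcirc_tmul, bcirc_tone] at h1 ⊢
    exact mul_eq_one_comm.1 h1
  rw [tinv, dif_pos hex]
  refine (Matrix.inv_eq_right_inv ?_).symm
  rw [← bcirc_tmul, hex.choose_spec.1, bcirc_tone]

/-! ### Positive definite tensors -/

lemma IsTPosDef.isUnit_bcirc [NeZero p] {A : Tensor n n p} (hA : IsTPosDef A) :
    IsUnit (bcirc A) :=
  (isTPosDef_iff_posDef.1 hA).isUnit

lemma IsTPosDef.quadForm_pos [NeZero p] {A : Tensor n n p} (hA : IsTPosDef A)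
    {x : Fin p × Fin n → ℂ} (hx : x ≠ 0) : 0 < quadForm x A :=
  (isTPosDef_iff_quadForm.1 hA).2 x hx

lemma convex_isTPosDef [NeZero p] : Convex ℝ {A : Tensor n n p | IsTPosDef A} := by
  intro A hA B hB a b ha hb hab
  rw [mem_ofPred_eq, isTPosDef_iff_quadForm] at *
  refine ⟨isTHermitian_iff.2 ?_, fun x hx => ?_⟩
  · have hA' := isTHermitian_iff.1 hA.1
    have hB' := isTHermitian_iff.1 hB.1
    rw [Matrix.IsHermitian, bcirc_add, bcirc_smul, bcirc_smul, conjTranspose_add,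
      conjTranspose_smul, conjTranspose_smul, hA', hB', star_trivial, star_trivial]
  · rw [map_add, map_smul, map_smul, smul_eq_mul, smul_eq_mul]
    have h1 := hA.2 x hx
    have h2 := hB.2 x hx
    rcases ha.eq_or_lt with rfl | ha
    · obtain rfl : b = 1 := by linarith
      simpa using h2
    · positivity

lemma isClosed_isTHermitian [NeZero p] : IsClosed {A : Tensor n n p | IsTHermitian A} := by
  simp only [isTHermitian_iff, Matrix.IsHermitian]
  exact isClosed_eq continuous_bcirc.matrix_conjTranspose continuous_bcirc

/-- Polarization: the entries of a T-Hermitian tensor are determined by its quadratic form. -/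
lemma IsTHermitian.apply_eq_quadForm [NeZero p] {A : Tensor n n p} (hA : IsTHermitian A)
    (i j : Fin n) (k : Fin p) :
    A (i, j, k) =
      ⟨(quadForm (Pi.single (k, i) 1 + Pi.single (0, j) 1) A - quadForm (Pi.single (k, i) 1) A
          - quadForm (Pi.single (0, j) 1) A) / 2,
        -(quadForm (Pi.single (k, i) 1 + Pi.single (0, j) Complex.I) A
          - quadForm (Pi.single (k, i) 1) A - quadForm (Pi.single (0, j) 1) A) / 2⟩ := by
  have h1 : A (i, j, k) = bcirc A (k, i) (0, j) := by simp [bcirc]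
  have h2 : bcirc A (0, j) (k, i) = star (bcirc A (k, i) (0, j)) :=
    ((isTHermitian_iff.1 hA).apply (0, j) (k, i)).symm
  rw [h1]
  have hs : ∀ (r : Fin p × Fin n) (z : ℂ),
      star (Pi.single r z : Fin p × Fin n → ℂ) = Pi.single r (star z) :=
    fun r z => (Pi.single_star (f := fun _ : Fin p × Fin n => ℂ) r z).symm
  apply Complex.ext <;>
  simp [quadForm_apply, hs, h2, Matrix.mulVec_add] <;> ring

lemma eq_of_quadForm_eq [NeZero p] {A B : Tensor n n p} (hA : IsTHermitian A)
    (hB : IsTHermitian B) (h : ∀ x, quadForm x A = quadForm x B) : A = B := by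
  ext ⟨i, j, k⟩
  simp only [hA.apply_eq_quadForm, hB.apply_eq_quadForm, h]

lemma exists_tendsto_of_quadForm [NeZero p] {A : ℕ → Tensor n n p}
    (hA : ∀ N, IsTHermitian (A N))
    (h : ∀ x, ∃ l, Tendsto (fun N => quadForm x (A N)) atTop (𝓝 l)) :
    ∃ L : Tensor n n p, Tendsto A atTop (𝓝 L) := by
  choose l hl using h
  have hent : ∀ a : Fin n × Fin n × Fin p, ∃ z, Tendsto (fun N => A N a) atTop (𝓝 z) := by
    rintro ⟨i, j, k⟩
    simp only [fun N => (hA N).apply_eq_quadForm i j k]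
    refine ⟨_, (Complex.equivRealProdCLM.symm.continuous.tendsto (_, _)).comp
      (Tendsto.prodMk_nhds ((((hl _).sub (hl _)).sub (hl _)).div_const 2)
        ((((hl _).sub (hl _)).sub (hl _)).neg.div_const 2))⟩
  choose z hz using hent
  exact ⟨WithLp.toLp 2 z,
    ((PiLp.continuous_toLp 2 _).tendsto z).comp (tendsto_pi_nhds.2 hz)⟩

/-! ### The Riemannian metric -/

lemma riemMetric_eq_trace [NeZero p] (P X Y : Tensor n n p) :
    riemMetric P X Y =
      (trace (bcirc (tinv P) * bcirc X * bcirc (tinv P) * bcirc Y)).re := by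
  simp only [riemMetric, ttrace, bcirc_tmul]

lemma riemMetric_neg_neg [NeZero p] (P X : Tensor n n p) :
    riemMetric P (-X) (-X) = riemMetric P X X := by
  simp [riemMetric_eq_trace, bcirc_neg]

lemma riemMetric_zero [NeZero p] (P Y : Tensor n n p) : riemMetric P 0 Y = 0 := by
  have : bcirc (0 : Tensor n n p) = 0 := rfl
  simp [riemMetric_eq_trace, this]

/-- The form `(Q, X) ↦ tr (Q X Q X)` is nonnegative for positive definite `Q` and Hermitian `X`:
factoring `Q = BᴴB`, it is the squared Frobenius norm of `B X Bᴴ`. -/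
lemma re_trace_mul_mul_mul_nonneg {ι : Type*} [Fintype ι] [DecidableEq ι]
    {Q X : Matrix ι ι ℂ} (hQ : Q.PosDef) (hX : X.IsHermitian) :
    0 ≤ (trace (Q * X * Q * X)).re := by
  obtain ⟨B, rfl⟩ := CStarAlgebra.nonneg_iff_eq_star_mul_self.mp hQ.posSemidef.nonneg
  rw [star_eq_conjTranspose]
  have h : trace (Bᴴ * B * X * (Bᴴ * B) * X) = trace (B * X * Bᴴ * (B * X * Bᴴ)ᴴ) := by
    rw [conjTranspose_mul, conjTranspose_mul, conjTranspose_conjTranspose, hX.eq]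
    simp only [Matrix.mul_assoc]
    rw [trace_mul_comm]
    simp only [Matrix.mul_assoc]
  rw [h]
  exact (Complex.nonneg_iff.1 (posSemidef_self_mul_conjTranspose _).trace_nonneg).1

/-- Cauchy–Schwarz for the trace form `(X, Y) ↦ tr (P⁻¹ X P⁻¹ Y)`, applied to a Hermitian `X` and
the rank one matrix `P x xᴴ P`. -/
lemma sq_le_trace_mul_sq {ι : Type*} [Fintype ι] [DecidableEq ι]
    {P X : Matrix ι ι ℂ} (hP : P.PosDef) (hX : X.IsHermitian) (x : ι → ℂ) :
    (star x ⬝ᵥ X *ᵥ x).re ^ 2 ≤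
      (trace (P⁻¹ * X * P⁻¹ * X)).re * (star x ⬝ᵥ P *ᵥ x).re ^ 2 := by
  rcases eq_or_ne x 0 with rfl | hx
  · simp
  have hdet := (Matrix.isUnit_iff_isUnit_det _).1 hP.isUnit
  set Y : Matrix ι ι ℂ := vecMulVec (P *ᵥ x) (star x ᵥ* P) with hYdef
  have hY : Y.IsHermitian := by
    rw [Matrix.IsHermitian, hYdef, conjTranspose_vecMulVec, star_mulVec, star_vecMul, star_star,
      hP.isHermitian.eq]
  have hQY : P⁻¹ * Y = vecMulVec x (star x ᵥ* P) := by
    rw [hYdef, mul_vecMulVec, mulVec_mulVec, nonsing_inv_mul _ hdet, one_mulVec]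
  have hXY : (trace (P⁻¹ * X * (P⁻¹ * Y))) = star x ⬝ᵥ X *ᵥ x := by
    rw [hQY, mul_vecMulVec, trace_vecMulVec, dotProduct_comm, ← mulVec_mulVec,
      ← dotProduct_mulVec, mulVec_mulVec, mulVec_mulVec,
      mul_nonsing_inv _ hdet, Matrix.one_mul]
  have hYY : trace (P⁻¹ * Y * (P⁻¹ * Y)) = (star x ⬝ᵥ P *ᵥ x) ^ 2 := by
    rw [hQY, vecMulVec_mul_vecMulVec, trace_vecMulVec, dotProduct_smul, dotProduct_comm x,
      ← dotProduct_mulVec, smul_eq_mul, sq]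
  have hq : 0 < star x ⬝ᵥ P *ᵥ x := hP.dotProduct_mulVec_pos hx
  obtain ⟨hqre, hqim⟩ := Complex.pos_iff.1 hq
  set q := (star x ⬝ᵥ P *ᵥ x).re
  have hq' : star x ⬝ᵥ P *ᵥ x = (q : ℂ) := Complex.ext rfl (by simpa using hqim.symm)
  set w := (star x ⬝ᵥ X *ᵥ x).re
  set g := (trace (P⁻¹ * X * P⁻¹ * X)).re with hg
  have key : ∀ t : ℝ, 0 ≤ g - 2 * t * w + t ^ 2 * q ^ 2 := by
    intro t
    have h := re_trace_mul_mul_mul_nonneg hP.inv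
      (hX.sub (hY.smul (k := t) (by simp [IsSelfAdjoint])))
    have e : trace (P⁻¹ * (X - t • Y) * P⁻¹ * (X - t • Y)) =
        trace (P⁻¹ * X * P⁻¹ * X) - t • trace (P⁻¹ * X * (P⁻¹ * Y))
          - t • trace (P⁻¹ * Y * (P⁻¹ * X)) + (t * t) • trace (P⁻¹ * Y * (P⁻¹ * Y)) := by
      simp only [Matrix.mul_sub, Matrix.sub_mul, trace_sub, Matrix.mul_smul, Matrix.smul_mul,
        trace_smul, Matrix.mul_assoc, smul_smul, smul_sub]
      abel
    rw [e, trace_mul_comm (P⁻¹ * Y), hXY, hYY, hq'] at h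
    simp only [Complex.add_re, Complex.sub_re, Complex.smul_re, smul_eq_mul, ← Complex.ofReal_pow,
      Complex.ofReal_re] at h
    linarith
  -- the value of `t` minimizing the quadratic polynomial
  have h := key (w / q ^ 2)
  have e : g - 2 * (w / q ^ 2) * w + (w / q ^ 2) ^ 2 * q ^ 2 = g - w ^ 2 / q ^ 2 := by
    field_simp
    ring
  rw [e, sub_nonneg, div_le_iff₀ (by positivity)] at h
  exact h

/-- A tangent vector `X` changes every quadratic form at `P` at a relative rate of at most its
Riemannian norm. -/
lemma abs_quadForm_le [NeZero p] {P X : Tensor n n p} (hP : IsTPosDef P) (hX : IsTHermitian X)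
    (x : Fin p × Fin n → ℂ) :
    |quadForm x X| ≤ √(riemMetric P X X) * quadForm x P := by
  have hP' := isTPosDef_iff_posDef.1 hP
  have h := sq_le_trace_mul_sq hP' (isTHermitian_iff.1 hX) x
  rw [← bcirc_tinv hP.isUnit_bcirc, ← riemMetric_eq_trace, ← quadForm_apply,
    ← quadForm_apply] at h
  have h0 : 0 ≤ quadForm x P :=
    (Complex.nonneg_iff.1 (hP'.posSemidef.dotProduct_mulVec_nonneg x)).1
  calc |quadForm x X| = √(quadForm x X ^ 2) := (Real.sqrt_sq_eq_abs _).symm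
    _ ≤ √(riemMetric P X X * quadForm x P ^ 2) := Real.sqrt_le_sqrt h
    _ = √(riemMetric P X X) * quadForm x P := by
      rw [Real.sqrt_mul' _ (sq_nonneg _), Real.sqrt_sq h0]

/-- The squared Riemannian norm is continuous in the base point and the tangent vector. -/
lemma continuousWithinAt_riemMetric [NeZero p] {P : Tensor n n p} (hP : IsTPosDef P)
    (X : Tensor n n p) :
    ContinuousWithinAt (fun z : Tensor n n p × Tensor n n p => riemMetric z.1 z.2 z.2)
      {z | IsTPosDef z.1} (P, X) := by
  have hdet := (Matrix.isUnit_iff_isUnit_det _).1 hP.isUnit_bcirc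
  have hinv : ContinuousAt (fun z : Tensor n n p × Tensor n n p => (bcirc z.1)⁻¹) (P, X) := by
    have h1 : ContinuousAt Inv.inv (bcirc P) := continuousAt_matrix_inv _ <| by
      simpa using continuousAt_inv₀ hdet.ne_zero
    exact ContinuousAt.comp (f := fun z : Tensor n n p × Tensor n n p => bcirc z.1) h1
      (continuous_bcirc.comp continuous_fst).continuousAt
  have hX : ContinuousAt (fun z : Tensor n n p × Tensor n n p => bcirc z.2) (P, X) :=
    (continuous_bcirc.comp continuous_snd).continuousAt
  have h : ContinuousAt (fun z : Tensor n n p × Tensor n n p =>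
      (trace ((bcirc z.1)⁻¹ * bcirc z.2 * (bcirc z.1)⁻¹ * bcirc z.2)).re) (P, X) :=
    Complex.continuous_re.continuousAt.comp
      ((continuous_id.matrix_trace.continuousAt).comp (((hinv.mul hX).mul hinv).mul hX))
  refine h.continuousWithinAt.congr (fun z hz => ?_) ?_
  · rw [riemMetric_eq_trace, bcirc_tinv (IsTPosDef.isUnit_bcirc hz)]
  · rw [riemMetric_eq_trace, bcirc_tinv hP.isUnit_bcirc]

/-! ### Lower bounds for the length of a path -/

section PiecewiseSmooth

variable {E : Type*} [NormedAddCommGroup E] [NormedSpace ℝ E]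

/-- A piecewise smooth path is differentiable in the interior, except at finitely many points. -/
lemma IsPiecewiseSmooth.exists_differentiableAt {γ : ℝ → E} {a b : ℝ}
    (h : IsPiecewiseSmooth γ a b) :
    ∃ s : Finset ℝ, ∀ t ∈ Ioo a b, t ∉ s → DifferentiableAt ℝ γ t := by
  obtain ⟨-, s, hs⟩ := h
  refine ⟨s, fun t ht hts => ?_⟩
  have hU : Ioo a b ∩ (↑s : Set ℝ)ᶜ ∈ 𝓝 t :=
    (isOpen_Ioo.inter s.finite_toSet.isClosed.isOpen_compl).mem_nhds ⟨ht, hts⟩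
  obtain ⟨ε, hε, hball⟩ := Metric.mem_nhds_iff.1 hU
  rw [Real.ball_eq_Ioo] at hball
  have h1 : t - ε / 2 ∈ Ioo a b := (hball ⟨by linarith, by linarith⟩).1
  have h2 : t + ε / 2 ∈ Ioo a b := (hball ⟨by linarith, by linarith⟩).1
  have hC := hs (t - ε / 2) (t + ε / 2) h1.1.le (by linarith) h2.2.le fun u hu =>
    (hball ⟨by linarith [hu.1], by linarith [hu.2]⟩).2
  exact (hC.contDiffAt (Icc_mem_nhds (by linarith) (by linarith))).differentiableAt (by simp)

end PiecewiseSmooth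

lemma isTHermitian_of_hasDerivAt [NeZero p] {γ : ℝ → Tensor n n p} {γ' : Tensor n n p} {t : ℝ}
    (h : HasDerivAt γ γ' t) (hγ : ∀ᶠ u in 𝓝 t, IsTHermitian (γ u)) : IsTHermitian γ' := by
  have hcoord : ∀ a, HasDerivAt (fun u => γ u a) (γ' a) t := fun a =>
    ((EuclideanSpace.proj a : Tensor n n p →L[ℂ] ℂ).restrictScalars ℝ).hasFDerivAt.comp_hasDerivAt
      t h
  ext ⟨i, j, k⟩
  have h1 : HasDerivAt (fun u => γ u (i, j, k)) (star (γ' (j, i, -k))) t := by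
    refine (hcoord (j, i, -k)).star.congr_of_eventuallyEq ?_
    filter_upwards [hγ] with u hu
    exact (congrArg (fun A : Tensor n n p => A (i, j, k)) hu).symm
  exact h1.unique (hcoord (i, j, k))

/-- Along a path the logarithm of every quadratic form varies by at most the length. -/
lemma abs_log_quadForm_sub_le_length [NeZero p] {A B : TPosDef n p} {a b : ℝ}
    {γ : ℝ → Tensor n n p} (h : IsPath A B a b γ) {x : Fin p × Fin n → ℂ} (hx : x ≠ 0) :
    ENNReal.ofReal |Real.log (quadForm x B.1) - Real.log (quadForm x A.1)| ≤ length a b γ := by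
  obtain ⟨s, hs⟩ := h.smooth.exists_differentiableAt
  rcases eq_or_ne (length a b γ) ⊤ with htop | hfin
  · simp [htop]
  set f : ℝ → ℝ := fun t => Real.log (quadForm x (γ t)) with hf
  have hpos : ∀ t ∈ Icc a b, 0 < quadForm x (γ t) := fun t ht => (h.mem t ht).quadForm_pos hx
  have hcont : ContinuousOn f (Icc a b) :=
    ((quadForm x).continuous.comp_continuousOn h.smooth.1).log fun t ht => (hpos t ht).ne'
  have hderiv : ∀ t ∈ Ioo a b \ (s : Set ℝ), HasDerivAt f (deriv f t) t ∧
      |deriv f t| ≤ √(riemMetric (γ t) (deriv γ t) (deriv γ t)) := by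
    rintro t ⟨ht, hts⟩
    have ht' := Ioo_subset_Icc_self ht
    have hγ : HasDerivAt γ (deriv γ t) t := (hs t ht hts).hasDerivAt
    have hH : IsTHermitian (deriv γ t) := isTHermitian_of_hasDerivAt hγ <| by
      filter_upwards [Icc_mem_nhds ht.1 ht.2] with u hu using (h.mem u hu).1
    have hq : HasDerivAt f (quadForm x (deriv γ t) / quadForm x (γ t)) t :=
      ((quadForm x).hasFDerivAt.comp_hasDerivAt t hγ).log (hpos t ht').ne'
    refine ⟨hq.differentiableAt.hasDerivAt, ?_⟩
    rw [hq.deriv, abs_div, abs_of_pos (hpos t ht'), div_le_iff₀ (hpos t ht')]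
    exact abs_quadForm_le (h.mem t ht') hH x
  have hae : ∀ᵐ t ∂volume.restrict (Icc a b), t ∈ Ioo a b \ (s : Set ℝ) := by
    rw [← restrict_Ioo_eq_restrict_Icc]
    filter_upwards [ae_restrict_mem measurableSet_Ioo,
      ae_restrict_of_ae (s.countable_toSet.ae_notMem volume)] with t h1 h2 using ⟨h1, h2⟩
  have hlen : ∫⁻ t in Icc a b, ENNReal.ofReal |deriv f t| ≤ length a b γ :=
    lintegral_mono_ae <| hae.mono fun t ht => ENNReal.ofReal_le_ofReal (hderiv t ht).2
  -- `deriv f` is dominated by the speed, hence integrable as soon as the length is finite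
  have hint : IntegrableOn (deriv f) (Icc a b) := by
    refine ⟨(measurable_deriv f).aestronglyMeasurable, ?_⟩
    rw [hasFiniteIntegral_iff_norm]
    exact hlen.trans_lt hfin.lt_top
  have hFTC : ∫ t in a..b, deriv f t = f b - f a :=
    integral_eq_of_hasDerivAt_off_countable_of_le f (deriv f) h.lt.le s.countable_toSet hcont
      (fun t ht => (hderiv t ht).1)
      ((intervalIntegrable_iff_integrableOn_Icc_of_le h.lt.le).2 hint)
  rw [← h.source, ← h.target, ← hFTC, intervalIntegral.integral_of_le h.lt.le,
    ← integral_Icc_eq_integral_Ioc]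
  refine le_trans ?_ hlen
  rw [← Real.norm_eq_abs, ofReal_norm]
  refine (enorm_integral_le_lintegral_enorm _).trans (lintegral_mono fun t => ?_)
  rw [← ofReal_norm, Real.norm_eq_abs]

lemma abs_log_quadForm_sub_le_riemDist [NeZero p] (A B : TPosDef n p) {x : Fin p × Fin n → ℂ}
    (hx : x ≠ 0) :
    ENNReal.ofReal |Real.log (quadForm x B.1) - Real.log (quadForm x A.1)| ≤ riemDist A B :=
  le_iInf fun _ => le_iInf fun _ => le_iInf fun _ => le_iInf fun h =>
    abs_log_quadForm_sub_le_length h hx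

/-! ### Operations on paths -/

lemma IsPath.riemDist_le [NeZero p] {A B : TPosDef n p} {a b : ℝ} {γ : ℝ → Tensor n n p}
    (h : IsPath A B a b γ) : riemDist A B ≤ length a b γ :=
  iInf_le_of_le a <| iInf_le_of_le b <| iInf_le_of_le γ <| iInf_le _ h

lemma length_comp_neg [NeZero p] (a b : ℝ) (γ : ℝ → Tensor n n p) :
    length (-b) (-a) (fun t => γ (-t)) = length a b γ := by
  simp only [length, deriv_comp_neg, riemMetric_neg_neg]
  have := (Measure.measurePreserving_neg (volume : Measure ℝ)).setLIntegral_comp_preimage_emb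
    (MeasurableEquiv.neg ℝ).measurableEmbedding
    (fun t => ENNReal.ofReal √(riemMetric (γ t) (deriv γ t) (deriv γ t))) (Icc a b)
  rwa [neg_preimage, neg_Icc] at this

lemma length_comp_sub_const [NeZero p] (a b c : ℝ) (γ : ℝ → Tensor n n p) :
    length (a + c) (b + c) (fun t => γ (t - c)) = length a b γ := by
  simp only [length, deriv_comp_sub_const]
  have := (measurePreserving_sub_right (volume : Measure ℝ) c).setLIntegral_comp_preimage_emb
    (MeasurableEquiv.subRight c).measurableEmbedding
    (fun t => ENNReal.ofReal √(riemMetric (γ t) (deriv γ t) (deriv γ t))) (Icc a b)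
  rwa [preimage_sub_const_Icc] at this

lemma IsPath.comp_neg [NeZero p] {A B : TPosDef n p} {a b : ℝ} {γ : ℝ → Tensor n n p}
    (h : IsPath A B a b γ) : IsPath B A (-b) (-a) fun t => γ (-t) where
  lt := neg_lt_neg h.lt
  mem t ht := h.mem _ ⟨le_neg.1 ht.2, neg_le.1 ht.1⟩
  smooth := by
    obtain ⟨hc, s, hs⟩ := h.smooth
    refine ⟨hc.comp continuous_neg.continuousOn fun t ht => ⟨le_neg.1 ht.2, neg_le.1 ht.1⟩,
      s.image Neg.neg, fun c d hac hcd hdb hcds => ?_⟩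
    refine (hs (-d) (-c) (le_neg.1 hdb) (neg_lt_neg hcd) (neg_le.1 hac) fun t ht hts => ?_).comp
      contDiff_neg.contDiffOn fun t ht => ⟨neg_le_neg ht.2, neg_le_neg ht.1⟩
    exact hcds (-t) ⟨lt_neg.1 ht.2, neg_lt.1 ht.1⟩ (Finset.mem_image_of_mem _ hts)
  source := by simp [h.target]
  target := by simp [h.source]

lemma IsPath.comp_sub_const [NeZero p] {A B : TPosDef n p} {a b : ℝ} {γ : ℝ → Tensor n n p}
    (h : IsPath A B a b γ) (r : ℝ) : IsPath A B (a + r) (b + r) fun t => γ (t - r) where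
  lt := by linarith [h.lt]
  mem t ht := h.mem _ ⟨by linarith [ht.1], by linarith [ht.2]⟩
  smooth := by
    obtain ⟨hc, s, hs⟩ := h.smooth
    refine ⟨hc.comp (by fun_prop) fun t ht => ⟨by linarith [ht.1], by linarith [ht.2]⟩,
      s.image (· + r), fun c d hac hcd hdb hcds => ?_⟩
    refine (hs (c - r) (d - r) (by linarith) (by linarith) (by linarith) fun t ht hts => ?_).comp
      (contDiff_id.sub contDiff_const).contDiffOn
      fun t ht => ⟨sub_le_sub_right ht.1 r, sub_le_sub_right ht.2 r⟩
    exact hcds (t + r) ⟨by linarith [ht.1], by linarith [ht.2]⟩ (Finset.mem_image_of_mem _ hts)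
  source := by simp [h.source]
  target := by simp [h.target]

lemma length_congr [NeZero p] {a b : ℝ} {γ₁ γ₂ : ℝ → Tensor n n p}
    (h : EqOn γ₁ γ₂ (Ioo a b)) : length a b γ₁ = length a b γ₂ := by
  rw [length, length, ← restrict_Ioo_eq_restrict_Icc]
  refine setLIntegral_congr_fun measurableSet_Ioo fun t ht => ?_
  simp only [h ht, (h.eventuallyEq_of_mem (isOpen_Ioo.mem_nhds ht)).deriv_eq]

lemma length_add_length [NeZero p] {a b c : ℝ} (hab : a ≤ b) (hbc : b ≤ c)
    (γ : ℝ → Tensor n n p) : length a c γ = length a b γ + length b c γ := by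
  simp only [length]
  rw [← restrict_Ioc_eq_restrict_Icc, ← restrict_Ioc_eq_restrict_Icc (a := a) (b := b),
    ← restrict_Ioc_eq_restrict_Icc (a := b), ← Ioc_union_Ioc_eq_Ioc hab hbc,
    lintegral_union measurableSet_Ioc (Ioc_disjoint_Ioc_of_le le_rfl)]

/-- The concatenation of two paths, the first of which ends at the parameter `b` at which the
second one starts. -/
lemma IsPath.concat [NeZero p] {A B C : TPosDef n p} {a b c : ℝ} {γ₁ γ₂ : ℝ → Tensor n n p}
    (h₁ : IsPath A B a b γ₁) (h₂ : IsPath B C b c γ₂) :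
    IsPath A C a c fun t => if t ≤ b then γ₁ t else γ₂ t := by
  set γ : ℝ → Tensor n n p := fun t => if t ≤ b then γ₁ t else γ₂ t with hγ
  have e₁ : ∀ t ≤ b, γ t = γ₁ t := fun t ht => if_pos ht
  have e₂ : ∀ t, b ≤ t → γ t = γ₂ t := fun t ht => by
    rcases ht.eq_or_lt with rfl | ht
    · rw [e₁ _ le_rfl, h₁.target, h₂.source]
    · exact if_neg ht.not_ge
  refine ⟨h₁.lt.trans h₂.lt, fun t ht => ?_, ⟨?_, ?_⟩, ?_, ?_⟩
  · rcases le_total t b with htb | htb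
    · rw [e₁ t htb]; exact h₁.mem t ⟨ht.1, htb⟩
    · rw [e₂ t htb]; exact h₂.mem t ⟨htb, ht.2⟩
  · rw [← Icc_union_Icc_eq_Icc h₁.lt.le h₂.lt.le]
    exact (h₁.smooth.1.congr fun t ht => e₁ t ht.2).union_of_isClosed
      (h₂.smooth.1.congr fun t ht => e₂ t ht.1) isClosed_Icc isClosed_Icc
  · obtain ⟨-, s₁, hs₁⟩ := h₁.smooth
    obtain ⟨-, s₂, hs₂⟩ := h₂.smooth
    refine ⟨insert b (s₁ ∪ s₂), fun u v hau huv hvc huvs => ?_⟩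
    simp only [Finset.mem_insert, Finset.mem_union, not_or] at huvs
    -- the break point `b` is not interior, so `[u, v]` lies on one side of it
    rcases le_or_gt v b with hvb | hbv
    · exact (hs₁ u v hau huv hvb fun t ht => (huvs t ht).2.1).congr
        fun t ht => e₁ t (ht.2.trans hvb)
    · have hbu : b ≤ u := not_lt.1 fun hub => (huvs b ⟨hub, hbv⟩).1 rfl
      exact (hs₂ u v hbu huv hvc fun t ht => (huvs t ht).2.2).congr
        fun t ht => e₂ t (hbu.trans ht.1)
  · rw [e₁ a h₁.lt.le, h₁.source]
  · rw [e₂ c h₂.lt.le, h₂.target]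

lemma riemDist_comm [NeZero p] (A B : TPosDef n p) : riemDist A B = riemDist B A := by
  have key : ∀ A B : TPosDef n p, riemDist B A ≤ riemDist A B := fun A B =>
    le_iInf fun a => le_iInf fun b => le_iInf fun γ => le_iInf fun h =>
      h.comp_neg.riemDist_le.trans (length_comp_neg a b γ).le
  exact le_antisymm (key B A) (key A B)

lemma riemDist_triangle [NeZero p] (A B C : TPosDef n p) :
    riemDist A C ≤ riemDist A B + riemDist B C := by
  have key : ∀ (a b : ℝ) (γ₁ : ℝ → Tensor n n p), IsPath A B a b γ₁ →
      ∀ (b' c : ℝ) (γ₂ : ℝ → Tensor n n p), IsPath B C b' c γ₂ →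
      riemDist A C ≤ length a b γ₁ + length b' c γ₂ := by
    intro a b γ₁ h₁ b' c γ₂ h₂
    -- shift the second path so that it starts at the parameter `b`
    have h₂' := h₂.comp_sub_const (b - b')
    have hl := length_comp_sub_const b' c (b - b') γ₂
    rw [add_sub_cancel] at h₂' hl
    refine (h₁.concat h₂').riemDist_le.trans ?_
    rw [length_add_length h₁.lt.le h₂'.lt.le, ← hl]
    refine add_le_add (length_congr fun t ht => if_pos ht.2.le).le
      (length_congr fun t ht => if_neg ht.1.not_ge).le
  rw [riemDist.eq_1 A B, riemDist.eq_1 B C]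
  simp only [ENNReal.iInf_add, ENNReal.add_iInf]
  simp only [le_iInf_iff]
  exact fun b' c γ₂ h₂ a b γ₁ h₁ => key a b γ₁ h₁ b' c γ₂ h₂

/-! ### Line segments -/

/-- The line segment from `A` to `B` is a path. -/
lemma isPath_lineMap [NeZero p] (A B : TPosDef n p) :
    IsPath A B 0 1 (AffineMap.lineMap A.1 B.1) where
  lt := zero_lt_one
  mem _ ht := convex_isTPosDef.lineMap_mem A.2 B.2 ht
  smooth := by
    have h : ContDiff ℝ ∞ (AffineMap.lineMap A.1 B.1 : ℝ → Tensor n n p) := by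
      rw [funext (AffineMap.lineMap_apply_module' A.1 B.1)]
      fun_prop
    exact ⟨h.continuous.continuousOn, ∅, fun _ _ _ _ _ _ => h.contDiffOn⟩
  source := AffineMap.lineMap_apply_zero _ _
  target := AffineMap.lineMap_apply_one _ _

lemma length_lineMap_le [NeZero p] {A B : Tensor n n p} {C : ℝ}
    (h : ∀ t ∈ Icc (0 : ℝ) 1, √(riemMetric (AffineMap.lineMap A B t) (B - A) (B - A)) ≤ C) :
    length 0 1 (AffineMap.lineMap A B) ≤ ENNReal.ofReal C := by
  have hd : ∀ t : ℝ, deriv (AffineMap.lineMap A B : ℝ → Tensor n n p) t = B - A :=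
    fun t => AffineMap.hasDerivAt_lineMap.deriv
  simp only [length, hd]
  calc _ ≤ ∫⁻ _ in Icc (0 : ℝ) 1, ENNReal.ofReal C :=
        setLIntegral_mono measurable_const fun t ht => ENNReal.ofReal_le_ofReal (h t ht)
    _ = ENNReal.ofReal C := by simp

lemma riemDist_lt_top [NeZero p] (A B : TPosDef n p) : riemDist A B < ⊤ := by
  have hc : ContinuousOn (fun t : ℝ =>
      √(riemMetric (AffineMap.lineMap A.1 B.1 t) (B.1 - A.1) (B.1 - A.1))) (Icc 0 1) := by
    intro t ht
    have hmem := (isPath_lineMap A B).mem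
    refine Real.continuous_sqrt.continuousAt.comp_continuousWithinAt ?_
    exact (continuousWithinAt_riemMetric (hmem t ht) (B.1 - A.1)).comp
      (f := fun t : ℝ => (AffineMap.lineMap A.1 B.1 t, B.1 - A.1))
      (AffineMap.lineMap_continuous.prodMk continuous_const).continuousWithinAt hmem
  obtain ⟨C, hC⟩ := isCompact_Icc.bddAbove_image hc
  exact ((isPath_lineMap A B).riemDist_le.trans
    (length_lineMap_le fun t ht => hC (mem_image_of_mem _ ht))).trans_lt ENNReal.ofReal_lt_top

lemma riemDist_self [NeZero p] (A : TPosDef n p) : riemDist A A = 0 := by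
  refine le_antisymm ((isPath_lineMap A A).riemDist_le.trans
    ((length_lineMap_le (C := 0) fun t _ => ?_).trans ENNReal.ofReal_zero.le)) bot_le
  simp [riemMetric_zero]

/-- Near `A` the Riemannian distance to `A` is small: the topology of tensors is finer than that
of the Riemannian distance. -/
lemma exists_riemDist_le [NeZero p] (A : TPosDef n p) {ε : ℝ} (hε : 0 < ε) :
    ∃ r > 0, ∀ B : TPosDef n p, ‖B.1 - A.1‖ < r → riemDist A B ≤ ENNReal.ofReal ε := by
  have h := (Real.continuous_sqrt.continuousAt.comp_continuousWithinAt
    (continuousWithinAt_riemMetric A.2 0)).eventually_lt_const (u := ε)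
    (by simpa [riemMetric_zero] using hε)
  obtain ⟨r, hr, hball⟩ := Metric.mem_nhdsWithin_iff.1 h
  refine ⟨r, hr, fun B hB => (isPath_lineMap A B).riemDist_le.trans
    (length_lineMap_le fun t ht => ?_)⟩
  refine (hball (a := (AffineMap.lineMap A.1 B.1 t, B.1 - A.1)) ⟨?_, ?_⟩).le
  · rw [Metric.mem_ball, Prod.dist_eq, max_lt_iff]
    refine ⟨?_, by simpa using hB⟩
    rw [dist_lineMap_left, dist_comm, dist_eq_norm, Real.norm_eq_abs, abs_of_nonneg ht.1]
    exact (mul_le_of_le_one_left (norm_nonneg _) ht.2).trans_lt hB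
  · exact (isPath_lineMap A B).mem t ht

/-! ### The metric space -/

lemma eq_of_riemDist_eq_zero [NeZero p] {A B : TPosDef n p} (h : riemDist A B = 0) : A = B := by
  refine Subtype.ext (eq_of_quadForm_eq A.2.1 B.2.1 fun x => ?_)
  rcases eq_or_ne x 0 with rfl | hx
  · simp [quadForm_apply]
  have h1 := abs_log_quadForm_sub_le_riemDist A B hx
  rw [h, nonpos_iff_eq_zero, ENNReal.ofReal_eq_zero, abs_nonpos_iff, sub_eq_zero] at h1
  exact (Real.log_injOn_pos (B.2.quadForm_pos hx) (A.2.quadForm_pos hx) h1).symm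

/-- The metric space of T-positive definite tensors with the Riemannian distance,
which is finite, so that passing to real numbers loses nothing. -/
abbrev riemMetricSpace (n p : ℕ) [NeZero p] : MetricSpace (TPosDef n p) where
  dist A B := (riemDist A B).toReal
  dist_self A := by simp [riemDist_self]
  dist_comm A B := by rw [riemDist_comm]
  dist_triangle A B C := by
    rw [← ENNReal.toReal_add (riemDist_lt_top A B).ne (riemDist_lt_top B C).ne]
    exact ENNReal.toReal_mono (ENNReal.add_lt_top.2
      ⟨riemDist_lt_top A B, riemDist_lt_top B C⟩).ne (riemDist_triangle A B C)
  eq_of_dist_eq_zero {A B} h := eq_of_riemDist_eq_zero <|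
    ((ENNReal.toReal_eq_zero_iff _).1 h).resolve_right (riemDist_lt_top A B).ne

/-- A sequence of T-positive definite tensors along which the logarithms of all quadratic forms are
Cauchy converges to a T-positive definite tensor. -/
lemma exists_tendsto_of_cauchySeq_log [NeZero p] {A : ℕ → TPosDef n p}
    (h : ∀ x : Fin p × Fin n → ℂ, x ≠ 0 →
      CauchySeq fun N => Real.log (quadForm x (A N).1)) :
    ∃ L : TPosDef n p, Tendsto (fun N => (A N).1) atTop (𝓝 L.1) := by
  have hq : ∀ x : Fin p × Fin n → ℂ, x ≠ 0 → ∃ l > 0,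
      Tendsto (fun N => quadForm x (A N).1) atTop (𝓝 l) := by
    intro x hx
    obtain ⟨l, hl⟩ := cauchySeq_tendsto_of_complete (h x hx)
    refine ⟨Real.exp l, Real.exp_pos l,
      ((Real.continuous_exp.tendsto l).comp hl).congr fun N => ?_⟩
    exact Real.exp_log ((A N).2.quadForm_pos hx)
  obtain ⟨L, hL⟩ := exists_tendsto_of_quadForm (A := fun N => (A N).1) (fun N => (A N).2.1)
    fun x => by
      rcases eq_or_ne x 0 with rfl | hx
      · exact ⟨0, by simp [quadForm_apply]⟩
      · obtain ⟨l, -, hl⟩ := hq x hx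
        exact ⟨l, hl⟩
  refine ⟨⟨L, isTPosDef_iff_quadForm.2 ⟨?_, fun x hx => ?_⟩⟩, hL⟩
  · exact isClosed_isTHermitian.mem_of_tendsto hL (.of_forall fun N => (A N).2.1)
  · obtain ⟨l, hl0, hl⟩ := hq x hx
    rwa [tendsto_nhds_unique (((quadForm x).continuous.tendsto L).comp hL) hl]

lemma completeSpace_riemMetricSpace [NeZero p] :
    @CompleteSpace (TPosDef n p) (riemMetricSpace n p).toUniformSpace := by
  let := riemMetricSpace n p
  have hd : ∀ A B : TPosDef n p, dist A B = (riemDist A B).toReal := fun _ _ => rfl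
  refine Metric.complete_of_cauchySeq_tendsto fun A hA => ?_
  obtain ⟨L, hL⟩ := exists_tendsto_of_cauchySeq_log (A := A) fun x hx => by
    rw [Metric.cauchySeq_iff'] at hA ⊢
    refine fun ε hε => (hA ε hε).imp fun N hN k hk => lt_of_le_of_lt ?_ (hN k hk)
    rw [dist_comm (A k), hd, Real.dist_eq,
      ← ENNReal.ofReal_le_iff_le_toReal (riemDist_lt_top _ _).ne]
    exact abs_log_quadForm_sub_le_riemDist (A N) (A k) hx
  refine ⟨L, Metric.tendsto_atTop'.2 fun ε hε => ?_⟩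
  obtain ⟨r, hr, hball⟩ := exists_riemDist_le L (half_pos hε)
  obtain ⟨N, hN⟩ := Metric.tendsto_atTop'.1 hL r hr
  refine ⟨N, fun k hk => ?_⟩
  have h1 := hball (A k) (by simpa [dist_eq_norm] using hN k hk)
  rw [dist_comm, hd]
  exact (ENNReal.toReal_le_of_le_ofReal (half_pos hε).le h1).trans_lt (half_lt_self hε)

end TProduct

end

/-- The Riemannian distance is (the finite, real-valued distance of) a metric on the space of
T-positive definite tensors, and this metric space is complete. -/
theorem mainTheorem9 (n p : ℕ) [NeZero p] :
    ∃ m : MetricSpace (TProduct.TPosDef n p),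
      (∀ A B : TProduct.TPosDef n p,
        ENNReal.ofReal (m.dist A B) = TProduct.riemDist A B) ∧
      @CompleteSpace (TProduct.TPosDef n p) m.toUniformSpace := by
  refine ⟨TProduct.riemMetricSpace n p, fun A B => ?_,
    TProduct.completeSpace_riemMetricSpace⟩
  exact ENNReal.ofReal_toReal (TProduct.riemDist_lt_top A B).ne
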